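/- A polyhedron in $\mathbb{R}^n$ is the solution set of a finite system of linear inequalities, and a polytope is a bounded polyhedron. The face lattice of a polytope $P$ is the set of all faces of $P$ (including $\varnothing$ and $P$ itself), partially ordered by inclusion. An extended formulation of $P \subseteq \mathbb{R}^n$ is a finite system of linear inequalities and linear equations in $e$ real variables (for some $e$), with solution set $Q \subseteq \mathbb{R}^e$, together with an affine map $\pi : \mathbb{R}^e \to \mathbb{R}^n$ such that $\pi(Q) = P$; its size is the number of inequalities in the system (equations are not counted). The extension complexity $\mathrm{xc}(P)$ is the smallest size of an extended formulation of $P$. Let $d \geq 0$, and let $P$ be a combinatorial $d$-cube, that is, a polytope in some $\mathbb{R}^n$ whose face lattice is isomorphic to the face lattice of the unit cube $[0,1]^d$. Then \[ \mathrm{xc}(P) = 2d . \] -/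

import Mathlib

open scoped Matrix

/-- A polyhedron in `ℝⁿ`: the solution set of a finite system `A x ≤ b` of linear inequalities. -/
def IsPolyhedron {n : ℕ} (P : Set (Fin n → ℝ)) : Prop :=
  ∃ (m : ℕ) (A : Matrix (Fin m) (Fin n) ℝ) (b : Fin m → ℝ), P = {x | A *ᵥ x ≤ b}

/-- A polytope in `ℝⁿ`: a bounded polyhedron. -/
def IsPolytope {n : ℕ} (P : Set (Fin n → ℝ)) : Prop :=
  IsPolyhedron P ∧ Bornology.IsBounded P

/-- The face lattice of `P`, ordered by inclusion. A face is the set of those points of `P` at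
which some valid linear inequality holds with equality, that is, an exposed subset of `P` in the
sense of `IsExposed`; both `∅` and `P` itself are faces. -/
abbrev FaceLattice {n : ℕ} (P : Set (Fin n → ℝ)) : Type :=
  {F : Set (Fin n → ℝ) // IsExposed ℝ P F}

/-- The unit cube `[0,1]ᵈ` in `ℝᵈ`. -/
def unitCube (d : ℕ) : Set (Fin d → ℝ) := Set.Icc 0 1

/-- A combinatorial `d`-cube in `ℝⁿ`: a polytope whose face lattice is isomorphic, as a partially
ordered set, to the face lattice of the unit cube `[0,1]ᵈ`. -/
def IsCombinatorialCube {n : ℕ} (d : ℕ) (P : Set (Fin n → ℝ)) : Prop :=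
  IsPolytope P ∧ Nonempty (FaceLattice P ≃o FaceLattice (unitCube d))

/-- `P` has an extended formulation of size `r`: for some `e`, a system of `r` linear inequalities
and any finite number of linear equations in `e` real variables, whose solution set is mapped
onto `P` by an affine map. -/
def HasExtendedFormulation {n : ℕ} (P : Set (Fin n → ℝ)) (r : ℕ) : Prop :=
  ∃ (e s : ℕ) (A : Matrix (Fin r) (Fin e) ℝ) (b : Fin r → ℝ)
    (C : Matrix (Fin s) (Fin e) ℝ) (g : Fin s → ℝ) (π : (Fin e → ℝ) →ᵃ[ℝ] (Fin n → ℝ)),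
    π '' {y | A *ᵥ y ≤ b ∧ C *ᵥ y = g} = P

/-- The extension complexity of `P`: the smallest size of an extended formulation of `P`
(`⊤` if there is none). -/
noncomputable def extensionComplexity {n : ℕ} (P : Set (Fin n → ℝ)) : ℕ∞ :=
  ⨅ (r : ℕ) (_ : HasExtendedFormulation P r), (r : ℕ∞)

/-! Upper bound: inside its affine hull, a polyhedron is cut out by one inequality per facet, and a
combinatorial cube has `2 * d` facets (`hasExtendedFormulation_of_faces`). Lower bound
(`card_le_of_fooling`): in an extended formulation, for each facet some inequality is tight on its
whole preimage but slack at a lift of a chosen point off the facet. If, of any two chosen points,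
one lies on the facet of the other, these inequalities are distinct. The vertices `foolingBits` of
the cube provide such points. Both arguments use only inclusions between faces, so they transfer
along an isomorphism of face lattices. -/

/-! ### Tight inequalities and relative interior points. -/

open Filter Topology in
/-- If every inequality of `A x ≤ b` tight at the solution `z` is tight at `y`, the segment from
`y` to `z` can be prolonged beyond `z` inside the solution set. -/
theorem exists_prolongation {m n : ℕ} (A : Matrix (Fin m) (Fin n) ℝ) (b : Fin m → ℝ)
    {y z : Fin n → ℝ} (hz : A *ᵥ z ≤ b) (h : ∀ i, (A *ᵥ z) i = b i → (A *ᵥ y) i = b i) :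
    ∃ ε : ℝ, 0 < ε ∧ A *ᵥ (z + ε • (z - y)) ≤ b := by
  have key : ∀ᶠ ε : ℝ in 𝓝[>] 0, ∀ i, (A *ᵥ z) i + ε * ((A *ᵥ z) i - (A *ᵥ y) i) ≤ b i := by
    rw [eventually_all]
    intro i
    rcases (hz i).lt_or_eq with hi | hi
    · have hc : Tendsto (fun ε : ℝ => (A *ᵥ z) i + ε * ((A *ᵥ z) i - (A *ᵥ y) i)) (𝓝 0)
          (𝓝 ((A *ᵥ z) i)) := by
        have : Continuous (fun ε : ℝ => (A *ᵥ z) i + ε * ((A *ᵥ z) i - (A *ᵥ y) i)) := by fun_prop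
        simpa using this.tendsto 0
      exact ((hc.eventually_lt_const hi).filter_mono nhdsWithin_le_nhds).mono fun _ h => h.le
    · exact Eventually.of_forall fun ε => by simp [hi, h i hi]
  obtain ⟨ε, h1, h2⟩ := (key.and self_mem_nhdsWithin).exists
  refine ⟨ε, h2, fun i => ?_⟩
  have := h1 i
  simpa [Matrix.mulVec_add, Matrix.mulVec_smul, Matrix.mulVec_sub] using this

/-- A nonempty convex set of solutions of `A x ≤ b` contains a point at which only those
inequalities are tight that are tight on the whole set. -/
theorem exists_mem_forall_tight {m n : ℕ} (A : Matrix (Fin m) (Fin n) ℝ) (b : Fin m → ℝ)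
    {K : Set (Fin n → ℝ)} (hK : Convex ℝ K) (hne : K.Nonempty) (hKA : ∀ y ∈ K, A *ᵥ y ≤ b) :
    ∃ z ∈ K, ∀ i, (A *ᵥ z) i = b i → ∀ y ∈ K, (A *ᵥ y) i = b i := by
  have main : ∀ S : Finset (Fin m),
      ∃ z ∈ K, ∀ i ∈ S, (A *ᵥ z) i = b i → ∀ y ∈ K, (A *ᵥ y) i = b i := by
    intro S
    induction S using Finset.induction_on with
    | empty => exact hne.imp fun z hz => ⟨hz, by simp⟩
    | insert i S _ ih =>
      obtain ⟨z, hz, hS⟩ := ih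
      by_cases hi : ∀ y ∈ K, (A *ᵥ y) i = b i
      · refine ⟨z, hz, fun j hj hjz => ?_⟩
        rcases Finset.mem_insert.1 hj with rfl | hj
        · exact hi
        · exact hS j hj hjz
      · push Not at hi
        obtain ⟨y, hy, hyi⟩ := hi
        -- An inequality tight at the midpoint is tight at both ends.
        refine ⟨(1 / 2 : ℝ) • z + (1 / 2 : ℝ) • y,
          hK hz hy (by norm_num) (by norm_num) (by norm_num), fun j hj hjz => ?_⟩
        have h1 := hKA z hz j
        have h2 := hKA y hy j
        simp only [Matrix.mulVec_add, Matrix.mulVec_smul, Pi.add_apply, Pi.smul_apply,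
          smul_eq_mul] at hjz
        rcases Finset.mem_insert.1 hj with rfl | hj
        · exact absurd (by linarith) hyi
        · exact hS j hj (by linarith)
  obtain ⟨z, hz, h⟩ := main Finset.univ
  exact ⟨z, hz, fun i => h i (Finset.mem_univ i)⟩

/-- A segment leaving a polyhedron meets its boundary. -/
theorem exists_exit_point {m n : ℕ} (A : Matrix (Fin m) (Fin n) ℝ) (b : Fin m → ℝ)
    {z x : Fin n → ℝ} (hz : A *ᵥ z ≤ b) (hx : ¬ A *ᵥ x ≤ b)
    (hzx : ∀ i, (A *ᵥ z) i = b i → (A *ᵥ x) i = b i) :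
    ∃ t : ℝ, 0 < t ∧ t < 1 ∧ A *ᵥ (z + t • (x - z)) ≤ b ∧
      ∃ i, (A *ᵥ z) i < b i ∧ (A *ᵥ (z + t • (x - z))) i = b i := by
  classical
  set V : Finset (Fin m) := Finset.univ.filter fun i => b i < (A *ᵥ x) i with hV
  have hVne : V.Nonempty := by
    rw [Pi.le_def] at hx
    push Not at hx
    obtain ⟨i, hi⟩ := hx
    exact ⟨i, by simpa [hV] using hi⟩
  have hVlt : ∀ i ∈ V, (A *ᵥ z) i < b i ∧ b i < (A *ᵥ x) i := fun i hi => by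
    have hi' : b i < (A *ᵥ x) i := by simpa [hV] using hi
    exact ⟨(hz i).lt_of_ne fun h => hi'.ne' (hzx i h), hi'⟩
  -- The ratio is the time at which the segment reaches hyperplane `i`; the smallest one is the
  -- moment of exit.
  obtain ⟨k, hk, hmin⟩ := V.exists_min_image
    (fun i => (b i - (A *ᵥ z) i) / ((A *ᵥ x) i - (A *ᵥ z) i)) hVne
  obtain ⟨hk1, hk2⟩ := hVlt k hk
  set t := (b k - (A *ᵥ z) k) / ((A *ᵥ x) k - (A *ᵥ z) k) with ht
  have ht0 : 0 < t := div_pos (by linarith) (by linarith)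
  have ht1 : t < 1 := by
    rw [ht, div_lt_one (by linarith)]
    linarith
  have hval : ∀ i, (A *ᵥ (z + t • (x - z))) i = (A *ᵥ z) i + t * ((A *ᵥ x) i - (A *ᵥ z) i) :=
    fun i => by simp [Matrix.mulVec_add, Matrix.mulVec_smul, Matrix.mulVec_sub]
  refine ⟨t, ht0, ht1, fun i => ?_, k, hk1, ?_⟩
  · rw [hval]
    by_cases hi : i ∈ V
    · obtain ⟨h1, h2⟩ := hVlt i hi
      have := (le_div_iff₀ (by linarith)).1 (hmin i hi)
      linarith
    · have h1 : (A *ᵥ x) i ≤ b i := by simpa [hV] using hi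
      have h2 := hz i
      nlinarith
  · rw [hval, ht, div_mul_cancel₀ _ (by linarith)]
    ring

/-- Points of a polyhedron tight only for implicit equations lie in no proper face. -/
theorem lt_of_forall_tight {m n : ℕ} (A : Matrix (Fin m) (Fin n) ℝ) (b : Fin m → ℝ)
    (l : (Fin n → ℝ) →ₗ[ℝ] ℝ) {c : ℝ} (hl : ∀ x, A *ᵥ x ≤ b → l x ≤ c) {y z : Fin n → ℝ}
    (hz : A *ᵥ z ≤ b) (hy : l y < c) (h : ∀ i, (A *ᵥ z) i = b i → (A *ᵥ y) i = b i) :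
    l z < c := by
  obtain ⟨ε, hε, hmem⟩ := exists_prolongation A b hz h
  have := hl _ hmem
  simp only [map_add, map_smul, map_sub, smul_eq_mul] at this
  by_contra! hc
  nlinarith

theorem linearMap_eq_mulVec {m n : ℕ} (l : Fin m → (Fin n → ℝ) →ₗ[ℝ] ℝ) (x : Fin n → ℝ) :
    (Matrix.of fun i j => l i (Pi.single j 1)) *ᵥ x = fun i => l i x := by
  ext i
  rw [LinearMap.pi_apply_eq_sum_univ (l i) x]
  simp only [Matrix.mulVec, dotProduct, Matrix.of_apply, smul_eq_mul]
  refine Finset.sum_congr rfl fun j _ => ?_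
  rw [mul_comm]
  congr 2
  ext k
  simp [Pi.single_apply, eq_comm]

/-! ### Bounds on extension complexity from faces. -/

/-- The fooling set bound for faces: `F k` is a nonempty face, `v k` a point outside it, and for
`k ≠ k'` one of `v k ∈ F k'`, `v k' ∈ F k` holds. -/
theorem card_le_of_fooling {n r : ℕ} {P : Set (Fin n → ℝ)} (hP : HasExtendedFormulation P r)
    {ι : Type*} [Fintype ι] (F : ι → Set (Fin n → ℝ)) (v : ι → Fin n → ℝ)
    (hF : ∀ k, IsExposed ℝ P (F k)) (hne : ∀ k, (F k).Nonempty) (hv : ∀ k, v k ∈ P)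
    (hvF : ∀ k, v k ∉ F k) (hfool : ∀ k k', k ≠ k' → v k ∈ F k' ∨ v k' ∈ F k) :
    Fintype.card ι ≤ r := by
  obtain ⟨e, s, A, b, C, g, π, rfl⟩ := hP
  choose y hy hyv using hv
  have key : ∀ k, ∃ i, (A *ᵥ y k) i ≠ b i ∧
      ∀ x, A *ᵥ x ≤ b ∧ C *ᵥ x = g → π x ∈ F k → (A *ᵥ x) i = b i := by
    intro k
    obtain ⟨l, hl⟩ := hF k (hne k)
    obtain ⟨p, hp⟩ := hne k
    have hp' := hp
    rw [hl] at hp'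
    obtain ⟨⟨q, hq, rfl⟩, hpmax⟩ := hp'
    have hmem : ∀ x, A *ᵥ x ≤ b ∧ C *ᵥ x = g → (π x ∈ F k ↔ l (π x) = l (π q)) := by
      intro x hx
      constructor
      · intro h
        rw [hl] at h
        exact le_antisymm (hpmax _ ⟨x, hx, rfl⟩) (h.2 _ ⟨q, hq, rfl⟩)
      · intro h
        rw [hl]
        exact ⟨⟨x, hx, rfl⟩, fun w hw => (hpmax w hw).trans h.ge⟩
    have hcomb : ∀ (x w : Fin e → ℝ) (α β : ℝ), α + β = 1 →
        l (π (α • x + β • w)) = α * l (π x) + β * l (π w) := by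
      intro x w α β h
      have := Convex.combo_affine_apply (f := (l.toLinearMap.toAffineMap.comp π)) (x := x) (y := w) h
      simpa using this
    obtain ⟨z, ⟨hzQ, hzl⟩, hz⟩ := exists_mem_forall_tight A b
      (K := {x | (A *ᵥ x ≤ b ∧ C *ᵥ x = g) ∧ l (π x) = l (π q)})
      (by
        rintro x ⟨⟨hx1, hx2⟩, hx3⟩ w ⟨⟨hw1, hw2⟩, hw3⟩ α β hα hβ hαβ
        refine ⟨⟨fun i => ?_, ?_⟩, ?_⟩
        · have h1 := mul_le_mul_of_nonneg_left (hx1 i) hα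
          have h2 := mul_le_mul_of_nonneg_left (hw1 i) hβ
          have h3 : α * b i + β * b i = b i := by rw [← add_mul, hαβ, one_mul]
          simp only [Matrix.mulVec_add, Matrix.mulVec_smul, Pi.add_apply, Pi.smul_apply,
            smul_eq_mul]
          linarith
        · rw [Matrix.mulVec_add, Matrix.mulVec_smul, Matrix.mulVec_smul, hx2, hw2, ← add_smul,
            hαβ, one_smul]
        · rw [hcomb _ _ _ _ hαβ, hx3, hw3, ← add_mul, hαβ, one_mul])
      ⟨q, hq, rfl⟩ (fun x hx => hx.1.1)
    by_contra! hcon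
    have htight : ∀ i, (A *ᵥ z) i = b i → (A *ᵥ y k) i = b i := by
      intro i hi
      by_contra hne
      obtain ⟨x, hx, hxF, hxi⟩ := hcon i hne
      exact hxi (hz i hi x ⟨hx, (hmem x hx).1 hxF⟩)
    -- `l ∘ π` is below its maximum at `y k` and attains it at `z`, so it would exceed it beyond
    -- `z`.
    obtain ⟨ε, hε, hpro⟩ := exists_prolongation A b hzQ.1 htight
    have hproC : C *ᵥ (z + ε • (z - y k)) = g := by
      rw [Matrix.mulVec_add, Matrix.mulVec_smul, Matrix.mulVec_sub, hzQ.2, (hy k).2]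
      simp
    have hle := hpmax _ ⟨_, ⟨hpro, hproC⟩, rfl⟩
    have heq : z + ε • (z - y k) = (1 + ε) • z + (-ε) • y k := by module
    rw [heq, hcomb _ _ _ _ (by ring), hzl] at hle
    have hylt : l (π (y k)) < l (π q) := by
      refine (hpmax _ ⟨_, hy k, rfl⟩).lt_of_ne fun h => hvF k ?_
      rw [← hyv k]
      exact (hmem _ (hy k)).2 h
    nlinarith
  choose i hi1 hi2 using key
  have hinj : Function.Injective i := by
    intro k k' h
    by_contra hkk
    rcases hfool k k' hkk with h' | h'
    · exact hi1 k (h ▸ hi2 k' (y k) (hy k) (by rwa [hyv]))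
    · exact hi1 k' (h ▸ hi2 k (y k') (hy k') (by rwa [hyv]))
  simpa using Fintype.card_le_of_injective i hinj

/-- A nonempty polyhedron, all of whose nonempty proper faces lie in one of `r` nonempty proper
faces, has an extended formulation of size `r`. -/
theorem hasExtendedFormulation_of_faces {n r : ℕ} {P : Set (Fin n → ℝ)} (hP : IsPolyhedron P)
    (hPne : P.Nonempty) (F : Fin r → Set (Fin n → ℝ)) (hF : ∀ k, IsExposed ℝ P (F k))
    (hne : ∀ k, (F k).Nonempty) (hproper : ∀ k, F k ≠ P)
    (hcover : ∀ G, IsExposed ℝ P G → G.Nonempty → G ≠ P → ∃ k, G ⊆ F k) :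
    HasExtendedFormulation P r := by
  classical
  obtain ⟨m, A, b, hPA⟩ := hP
  have hPmem : ∀ x, x ∈ P ↔ A *ᵥ x ≤ b := fun x => by rw [hPA]; rfl
  choose l hl using fun k => hF k (hne k)
  choose p hp using hne
  have hpP : ∀ k, p k ∈ P := fun k => (hF k).subset (hp k)
  have hmax : ∀ k, ∀ x ∈ P, l k x ≤ l k (p k) := fun k x hx => by
    have := hp k
    rw [hl k] at this
    exact this.2 x hx
  have hmemF : ∀ k, ∀ x ∈ P, (x ∈ F k ↔ l k x = l k (p k)) := fun k x hx => by
    constructor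
    · intro h
      rw [hl k] at h
      exact le_antisymm (hmax k x hx) (h.2 _ (hpP k))
    · intro h
      rw [hl k]
      exact ⟨hx, fun w hw => (hmax k w hw).trans h.ge⟩
  have hconv : Convex ℝ P := by
    rw [hPA]
    exact (convex_Iic b).linear_preimage A.mulVecLin
  obtain ⟨z, hzP, hz⟩ := exists_mem_forall_tight A b hconv hPne (fun y hy => (hPmem y).1 hy)
  have hzlt : ∀ k, l k z < l k (p k) := by
    intro k
    obtain ⟨y, hyP, hyF⟩ : ∃ y ∈ P, y ∉ F k := by
      by_contra! h
      exact hproper k ((hF k).subset.antisymm h)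
    exact lt_of_forall_tight A b (l k).toLinearMap (fun x hx => hmax k x ((hPmem x).2 hx))
      ((hPmem z).1 hzP) ((hmax k y hyP).lt_of_ne fun h => hyF ((hmemF k y hyP).2 h))
      (fun i hi => hz i hi y hyP)
  -- No new variables: rows tight at `z`, hence on all of `P`, become equations, which cost nothing;
  -- the other rows are replaced by `0 = 0`.
  refine ⟨n, m, Matrix.of fun k j => l k (Pi.single j 1), fun k => l k (p k),
    Matrix.of fun i j => if (A *ᵥ z) i = b i then A i j else 0,
    fun i => if (A *ᵥ z) i = b i then b i else 0, AffineMap.id ℝ _, ?_⟩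
  have hC : ∀ x i, ((Matrix.of fun i j => if (A *ᵥ z) i = b i then A i j else 0) *ᵥ x) i =
      if (A *ᵥ z) i = b i then (A *ᵥ x) i else 0 := by
    intro x i
    by_cases h : (A *ᵥ z) i = b i <;> simp [Matrix.mulVec, dotProduct] at h ⊢
  have hL := linearMap_eq_mulVec fun k => (l k).toLinearMap
  simp only [ContinuousLinearMap.coe_coe] at hL
  simp only [AffineMap.coe_id, Set.image_id]
  ext x
  simp only [Set.mem_ofPred_eq, hL]
  constructor
  · rintro ⟨hx1, hx2⟩
    by_contra hxP
    obtain ⟨t, ht0, ht1, hw, i, hi, hwi⟩ := exists_exit_point A b ((hPmem z).1 hzP)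
      (fun h => hxP ((hPmem x).2 h)) (fun i hi => by
        have := congrFun hx2 i
        simpa only [hC, hi, if_true] using this)
    set w := z + t • (x - z) with hwdef
    -- The exit point `w` lies in some `F k`, where `l k` is maximal; but `l k` is smaller at `z`
    -- and no larger at `x`, hence smaller at `w`.
    obtain ⟨k, hk⟩ := hcover {y ∈ P | (A *ᵥ y) i = b i}
      (fun _ => ⟨(LinearMap.proj i ∘ₗ A.mulVecLin).toContinuousLinearMap, by
        ext y
        simp only [Set.mem_ofPred_eq, LinearMap.coe_toContinuousLinearMap', LinearMap.coe_comp,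
          Function.comp_apply, Matrix.mulVecLin_apply, LinearMap.proj_apply]
        refine and_congr_right fun hy => ⟨fun h u hu => h ▸ (hPmem u).1 hu i, fun h => ?_⟩
        exact le_antisymm ((hPmem y).1 hy i) (hwi ▸ h w ((hPmem w).2 hw))⟩)
      ⟨w, (hPmem w).2 hw, hwi⟩
      (fun h => hi.ne (h.symm ▸ hzP : z ∈ {y ∈ P | (A *ᵥ y) i = b i}).2)
    have h1 := (hmemF k w ((hPmem w).2 hw)).1 (hk ⟨(hPmem w).2 hw, hwi⟩)
    have h2 := hzlt k
    have h3 : l k x ≤ l k (p k) := hx1 k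
    simp only [hwdef, map_add, map_smul, map_sub, smul_eq_mul] at h1
    nlinarith
  · intro hx
    refine ⟨fun k => hmax k x hx, funext fun i => ?_⟩
    rw [hC]
    by_cases h : (A *ᵥ z) i = b i
    · simp only [h, if_true, hz i h x hx]
    · simp only [h, if_false]

/-! ### Faces of the unit cube. -/

/-- The coordinate value `0` or `1` encoded by a Boolean. -/
def bitValue (s : Bool) : ℝ := if s then 1 else 0

/-- The facet `xᵢ = s` of the unit cube. -/
def cubeFacet {d : ℕ} (k : Fin d × Bool) : Set (Fin d → ℝ) :=
  {x ∈ unitCube d | x k.1 = bitValue k.2}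

/-- The vertex of the unit cube with given bits. -/
def cubeVertex {d : ℕ} (u : Fin d → Bool) : Fin d → ℝ := fun j => bitValue (u j)

theorem cubeVertex_mem {d : ℕ} (u : Fin d → Bool) : cubeVertex u ∈ unitCube d := by
  constructor <;> intro j <;> cases h : u j <;> simp [cubeVertex, bitValue, h]

theorem cubeVertex_mem_cubeFacet {d : ℕ} (u : Fin d → Bool) (k : Fin d × Bool) :
    cubeVertex u ∈ cubeFacet k ↔ u k.1 = k.2 := by
  simp only [cubeFacet, Set.mem_ofPred_eq, cubeVertex_mem, true_and, cubeVertex]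
  cases u k.1 <;> cases k.2 <;> simp [bitValue]

theorem cubeFacet_nonempty {d : ℕ} (k : Fin d × Bool) : (cubeFacet k).Nonempty :=
  ⟨cubeVertex fun _ => k.2, (cubeVertex_mem_cubeFacet _ k).2 rfl⟩

theorem cubeFacet_ne {d : ℕ} (k : Fin d × Bool) : cubeFacet k ≠ unitCube d := fun h => by
  have := h ▸ cubeVertex_mem (d := d) fun _ => !k.2
  simp [cubeVertex_mem_cubeFacet] at this

theorem isExposed_cubeFacet {d : ℕ} (k : Fin d × Bool) :
    IsExposed ℝ (unitCube d) (cubeFacet k) := by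
  intro _
  obtain ⟨i, s⟩ := k
  -- The factor is the sign: `1` for `s = true`, `-1` for `s = false`.
  refine ⟨(2 * bitValue s - 1) • ContinuousLinearMap.proj i, ?_⟩
  ext x
  refine and_congr_right fun hx => ?_
  have h0 := hx.1 i
  have h1 := hx.2 i
  simp only [Pi.zero_apply, Pi.one_apply] at h0 h1
  cases s <;> simp [bitValue]
  · refine ⟨fun h y hy => h ▸ hy.1 i, fun h => le_antisymm ?_ h0⟩
    simpa [cubeVertex, bitValue] using h _ (cubeVertex_mem fun _ => false)
  · refine ⟨fun h y hy => h ▸ hy.2 i, fun h => le_antisymm h1 ?_⟩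
    simpa [cubeVertex, bitValue] using h _ (cubeVertex_mem fun _ => true)

theorem isExposed_cubeVertex {d : ℕ} (u : Fin d → Bool) :
    IsExposed ℝ (unitCube d) {cubeVertex u} := by
  intro _
  have hterm : ∀ x ∈ unitCube d, ∀ j, (2 * bitValue (u j) - 1) * x j ≤
      (2 * bitValue (u j) - 1) * cubeVertex u j := by
    intro x hx j
    have h0 := hx.1 j
    have h1 := hx.2 j
    simp only [Pi.zero_apply, Pi.one_apply] at h0 h1
    cases h : u j <;> simp [cubeVertex, bitValue, h] <;> linarith
  refine ⟨∑ j, (2 * bitValue (u j) - 1) • ContinuousLinearMap.proj j, ?_⟩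
  ext x
  simp only [Set.mem_singleton_iff, Set.mem_ofPred_eq, sum_apply,
    smul_apply, ContinuousLinearMap.proj_apply, smul_eq_mul]
  constructor
  · rintro rfl
    exact ⟨cubeVertex_mem u, fun y hy => Finset.sum_le_sum fun j _ => hterm y hy j⟩
  · rintro ⟨hx, hmax⟩
    have heq := (Finset.sum_eq_sum_iff_of_le fun j _ => hterm x hx j).1
      (le_antisymm (Finset.sum_le_sum fun j _ => hterm x hx j) (hmax _ (cubeVertex_mem u)))
    ext j
    refine mul_left_cancel₀ ?_ (heq j (Finset.mem_univ j))
    cases u j <;> norm_num [bitValue]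

/-- Every nonempty proper face of the unit cube lies in a facet. -/
theorem exists_subset_cubeFacet {d : ℕ} {G : Set (Fin d → ℝ)} (hG : IsExposed ℝ (unitCube d) G)
    (hne : G.Nonempty) (hproper : G ≠ unitCube d) : ∃ k, G ⊆ cubeFacet k := by
  obtain ⟨l, rfl⟩ := hG hne
  by_cases h : ∀ i, l (Pi.single i 1) = 0
  · have hl : l = 0 := by
      ext x
      rw [← ContinuousLinearMap.coe_coe, LinearMap.pi_apply_eq_sum_univ]
      refine Finset.sum_eq_zero fun i _ => ?_
      have hi : (fun j => if i = j then 1 else 0 : Fin d → ℝ) = Pi.single i 1 := by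
        ext j
        simp [Pi.single_apply, eq_comm]
      simp [hi, h i]
    exact absurd (by ext x; simp [hl]) hproper
  · push Not at h
    obtain ⟨i, hi⟩ := h
    -- Moving `x i` to the end favoured by the sign of this coefficient would increase `l` unless `x
    -- i` is already there.
    refine ⟨(i, decide (0 < l (Pi.single i 1))), fun x hx => ⟨hx.1, ?_⟩⟩
    have h0 := hx.1.1 i
    have h1 := hx.1.2 i
    simp only [Pi.zero_apply, Pi.one_apply] at h0 h1
    have hcmp : ∀ c : ℝ, 0 ≤ c → c ≤ 1 → (c - x i) * l (Pi.single i 1) ≤ 0 := by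
      intro c hc0 hc1
      have hupd : Function.update x i c = x + (c - x i) • Pi.single i (1 : ℝ) := by
        ext j
        rcases eq_or_ne j i with rfl | hj
        · simp
        · simp [hj]
      have hmem : Function.update x i c ∈ unitCube d := by
        constructor <;> intro j <;> rcases eq_or_ne j i with rfl | hj
        · simpa
        · simpa [hj] using hx.1.1 j
        · simpa
        · simpa [hj] using hx.1.2 j
      have := hx.2 _ hmem
      rw [hupd, map_add, map_smul, smul_eq_mul] at this
      linarith
    by_cases hpos : 0 < l (Pi.single i 1)
    · have := hcmp 1 zero_le_one le_rfl
      simp only [hpos, decide_true, bitValue, if_true]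
      nlinarith
    · have hneg := lt_of_le_of_ne (not_lt.1 hpos) hi
      have := hcmp 0 le_rfl zero_le_one
      simp only [hpos, decide_false, bitValue]
      simp
      nlinarith

/-- A fooling set of the unit cube: this vertex avoids the facet indexed by `k`. -/
def foolingBits {d : ℕ} (k : Fin d × Bool) : Fin d → Bool :=
  fun j => if j ≤ k.1 then !k.2 else k.2

theorem foolingBits_self {d : ℕ} (k : Fin d × Bool) : foolingBits k k.1 ≠ k.2 := by
  simp [foolingBits]

/-- For `i < j`, the vertex of `(i, s)` has bit `s` at `j` and that of `(j, t)` has bit `!t` at `i`;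
either `s = t` or `!t = s`. -/
theorem foolingBits_or {d : ℕ} (k k' : Fin d × Bool) (h : k ≠ k') :
    foolingBits k k'.1 = k'.2 ∨ foolingBits k' k.1 = k.2 := by
  obtain ⟨i, s⟩ := k
  obtain ⟨j, t⟩ := k'
  simp only [foolingBits]
  rcases lt_trichotomy i j with hij | rfl | hij
  · simp only [hij.not_ge, hij.le, if_true, if_false]
    cases s <;> cases t <;> simp
  · cases s <;> cases t <;> simp_all
  · simp only [hij.not_ge, hij.le, if_true, if_false]
    cases s <;> cases t <;> simp

theorem isExposed_empty_set {n : ℕ} (P : Set (Fin n → ℝ)) : IsExposed ℝ P ∅ :=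
  fun h => absurd h Set.not_nonempty_empty

/-! ### Transfer to combinatorial cubes. -/

/-- An isomorphism of face lattices preserves nonemptiness. -/
theorem FaceLattice.nonempty_map {n m : ℕ} {P : Set (Fin n → ℝ)} {Q : Set (Fin m → ℝ)}
    (f : FaceLattice P ≃o FaceLattice Q) {F : FaceLattice P} (h : F.1.Nonempty) :
    (f F).1.Nonempty := by
  by_contra hcon
  rw [Set.not_nonempty_iff_eq_empty] at hcon
  have hle : f F ≤ f ⟨∅, isExposed_empty_set P⟩ := by
    change (f F).1 ⊆ _
    rw [hcon]
    exact Set.empty_subset _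
  obtain ⟨x, hx⟩ := h
  exact (f.le_iff_le.1 hle : F.1 ⊆ ∅) hx

/-- An isomorphism of face lattices maps proper faces to proper faces. -/
theorem FaceLattice.ne_map {n m : ℕ} {P : Set (Fin n → ℝ)} {Q : Set (Fin m → ℝ)}
    (f : FaceLattice P ≃o FaceLattice Q) {F : FaceLattice P} (h : F.1 ≠ P) : (f F).1 ≠ Q := by
  intro hcon
  have hle : f ⟨P, IsExposed.refl P⟩ ≤ f F := by
    change _ ⊆ (f F).1
    rw [hcon]
    exact (f _).2.subset
  exact h (F.2.subset.antisymm (f.le_iff_le.1 hle : P ⊆ F.1))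

theorem IsCombinatorialCube.hasExtendedFormulation {n d : ℕ} {P : Set (Fin n → ℝ)}
    (hP : IsCombinatorialCube d P) : HasExtendedFormulation P (2 * d) := by
  obtain ⟨⟨hpoly, -⟩, ⟨f⟩⟩ := hP
  let e : Fin (2 * d) ≃ Fin d × Bool :=
    (Fintype.equivFinOfCardEq (by simp [mul_comm])).symm
  let F : Fin (2 * d) → FaceLattice P := fun k => f.symm ⟨_, isExposed_cubeFacet (e k)⟩
  have hPne : P.Nonempty := by
    obtain ⟨x, hx⟩ := FaceLattice.nonempty_map f.symm
      (F := ⟨unitCube d, IsExposed.refl _⟩) ⟨_, cubeVertex_mem fun _ => true⟩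
    exact ⟨x, (f.symm _).2.subset hx⟩
  refine hasExtendedFormulation_of_faces hpoly hPne (fun k => (F k).1) (fun k => (F k).2)
    (fun k => FaceLattice.nonempty_map _ (cubeFacet_nonempty _))
    (fun k => FaceLattice.ne_map _ (cubeFacet_ne _)) fun G hG hGne hGP => ?_
  obtain ⟨k, hk⟩ := exists_subset_cubeFacet (f ⟨G, hG⟩).2
    (FaceLattice.nonempty_map f hGne) (FaceLattice.ne_map f hGP)
  refine ⟨e.symm k, ?_⟩
  have : (⟨G, hG⟩ : FaceLattice P) ≤ F (e.symm k) := by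
    rw [f.le_symm_apply]
    simp only [Equiv.apply_symm_apply]
    exact hk
  exact this

theorem IsCombinatorialCube.two_mul_le {n d r : ℕ} {P : Set (Fin n → ℝ)}
    (hP : IsCombinatorialCube d P) (hr : HasExtendedFormulation P r) : 2 * d ≤ r := by
  obtain ⟨-, ⟨f⟩⟩ := hP
  let F : Fin d × Bool → FaceLattice P := fun k => f.symm ⟨_, isExposed_cubeFacet k⟩
  let V : Fin d × Bool → FaceLattice P := fun k =>
    f.symm ⟨_, isExposed_cubeVertex (foolingBits k)⟩
  have hVF : ∀ k k', V k ≤ F k' ↔ foolingBits k k'.1 = k'.2 := fun k k' => by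
    rw [f.symm.le_iff_le, ← cubeVertex_mem_cubeFacet]
    exact Set.singleton_subset_iff
  -- `V k` need not be known to be a single point: any of its points outside `F k` serves, since it
  -- lies in every `F k'` containing `V k`.
  have hex : ∀ k, ∃ v ∈ (V k).1, v ∉ (F k).1 := fun k =>
    Set.not_subset.1 fun h => foolingBits_self k ((hVF k k).1 h)
  choose v hvV hvF using hex
  have := card_le_of_fooling hr (fun k => (F k).1) v (fun k => (F k).2)
    (fun k => FaceLattice.nonempty_map _ (cubeFacet_nonempty k))
    (fun k => (V k).2.subset (hvV k)) hvF fun k k' h =>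
      (foolingBits_or k k' h).imp (fun h => (hVF k k').2 h (hvV k))
        (fun h => (hVF k' k).2 h (hvV k'))
  simpa [mul_comm] using this

theorem mainTheorem3 {n : ℕ} (d : ℕ) (P : Set (Fin n → ℝ)) (hP : IsCombinatorialCube d P) :
    extensionComplexity P = ((2 * d : ℕ) : ℕ∞) :=
  le_antisymm (iInf₂_le _ hP.hasExtendedFormulation)
    (le_iInf₂ fun _ hr => Nat.cast_le.2 (hP.two_mul_le hr))
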